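/- Let $K$ be a cyclic cubic number field, i.e. a Galois extension of $\mathbb{Q}$ of degree $3$ with cyclic Galois group, and suppose that its conductor $f$ (the least positive integer $m$ such that $K$ embeds into $\mathbb{Q}(\zeta_m)$) is a prime number. Let $\chi$ be any primitive Dirichlet character modulo $f$ of order $3$ such that a rational prime $p$ splits in $K$ if and only if $\chi(p)=1$. Let $q_1<q_2$ be the two smallest rational primes that are inert in $K$, and let $r$ be the smallest positive integer such that $\gcd(r,q_1q_2)=1$ and $\chi(r)=\chi(q_2)^{-1}$. If $q_1\neq 2$ and $$f\ \geq\ q_1q_2\max(3r,\,10q_1),$$ then $K$ is not norm-Euclidean; that is, it is not true that for all $\alpha,\beta\in\mathcal{O}_K$ with $\beta\neq 0$ there exists $\gamma\in\mathcal{O}_K$ with $|N_{K/\mathbb{Q}}(\alpha-\gamma\beta)|<|N_{K/\mathbb{Q}}(\beta)|$. -/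

import Mathlib

open NumberField

/-- `K` is a cyclic cubic field: a Galois extension of `ℚ` of degree three whose Galois group
is cyclic. -/
def IsCyclicCubic (K : Type*) [Field K] [NumberField K] : Prop :=
  IsGalois ℚ K ∧ IsCyclic (K ≃ₐ[ℚ] K) ∧ Module.finrank ℚ K = 3

/-- `f` is the conductor of the abelian number field `K`: the least positive integer `m` such that
`K` embeds into the `m`-th cyclotomic field. -/
def IsConductor (K : Type*) [Field K] [NumberField K] (f : ℕ) : Prop :=
  IsLeast {m : ℕ | 0 < m ∧ Nonempty (K →ₐ[ℚ] CyclotomicField m ℚ)} f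

/-- `K` is norm-Euclidean: division with remainder holds in the ring of integers with respect to
the absolute value of the norm. -/
def IsNormEuclidean (K : Type*) [Field K] [NumberField K] : Prop :=
  ∀ α β : 𝓞 K, β ≠ 0 → ∃ γ : 𝓞 K,
    |Algebra.norm ℤ (α - γ * β)| < |Algebra.norm ℤ β|

/-- The rational prime `p` is inert in `K`: it generates a prime ideal of the ring of integers. -/
def IsInertPrime (K : Type*) [Field K] [NumberField K] (p : ℕ) : Prop :=
  p.Prime ∧ (Ideal.span {(p : 𝓞 K)}).IsPrime

/-- The rational prime `p` splits (completely) in `K`: the number of primes of the ring of integers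
above `p` equals the degree of `K`. -/
def SplitsIn (K : Type*) [Field K] [NumberField K] (p : ℕ) : Prop :=
  p.Prime ∧ ((Ideal.span {(p : ℤ)}).primesOver (𝓞 K)).ncard = Module.finrank ℚ K

/-- `q₁ < q₂` are the two smallest rational primes that are inert in `K`. -/
def AreTwoSmallestInertPrimes (K : Type*) [Field K] [NumberField K] (q₁ q₂ : ℕ) : Prop :=
  IsLeast {p : ℕ | IsInertPrime K p} q₁ ∧ IsLeast {p : ℕ | IsInertPrime K p ∧ q₁ < p} q₂

/-- `χ` is a character belonging to the cyclic cubic field `K` of conductor `f`: a primitive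
Dirichlet character modulo `f` of order three such that a rational prime `p` splits in `K` if and
only if `χ p = 1`. -/
def IsCubicCharacterOf (K : Type*) [Field K] [NumberField K] {f : ℕ}
    (χ : DirichletCharacter ℂ f) : Prop :=
  χ.IsPrimitive ∧ orderOf χ = 3 ∧ ∀ p : ℕ, p.Prime → (SplitsIn K p ↔ χ (p : ZMod f) = 1)

/-- `r` is the smallest positive integer with `(r, q₁ q₂) = 1` and `χ r = (χ q₂)⁻¹`. -/
def IsSmallestAuxiliary {f : ℕ} (χ : DirichletCharacter ℂ f) (q₁ q₂ r : ℕ) : Prop :=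
  IsLeast {n : ℕ | 0 < n ∧ Nat.Coprime n (q₁ * q₂) ∧
    χ (n : ZMod f) = (χ (q₂ : ZMod f))⁻¹} r

open scoped Pointwise

/-! This is Heilbronn's argument. As `K` lies in the `f`-th cyclotomic field, `f` is totally
ramified. If `K` is norm-Euclidean, the prime above `f` is principal, and dividing an integer `x` by
its generator leaves a remainder whose norm is congruent to `x ^ 3` modulo `f` and less than `f` in
absolute value. Hence, if `0 < a < f` and `χ a = 1`, one of `a`, `a - f` is a norm. Inert primes
occur in norms only to exponents divisible by three, so it suffices to write `f = a + b` with `χ a =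
1` and such an exponent violated in both parts (`CubicInertData.exists_splitting`).

Take `a = q₂ * r * k` with `0 < k < q₁` and `q₁ ∣ f - a`. If `q₁ ^ 2 ∣ f - a`, shifting `k` by `q₁`
or `2 * q₁` repairs this, provided that `χ` is still 1 there. Both shifts can fail only when `k = 2
* h` and `2 * h + q₁`, `h + q₁` are inert primes; their values are `χ q₂` or its inverse, so they
can serve as factors of a new `a`. -/

/-- Some `q` satisfying `I` divides `n` to an exact power that is not a multiple of three. -/
def HasNonCubePart (I : ℕ → Prop) (n : ℕ) : Prop :=
  ∃ q e m : ℕ, I q ∧ ¬ 3 ∣ e ∧ ¬ q ∣ m ∧ n = q ^ e * m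

/-- A cubic character modulo the prime `f` for which the primes below `f` of value `≠ 1` are
described by the predicate `I`, together with the two smallest such primes. -/
structure CubicInertData {f : ℕ} (χ : DirichletCharacter ℂ f) (I : ℕ → Prop) (q₁ q₂ : ℕ) :
    Prop where
  prime_modulus : f.Prime
  cube : ∀ n : ℕ, 0 < n → n < f → χ (n : ZMod f) ^ 3 = 1
  prime : ∀ {p}, I p → p.Prime
  ne_one : ∀ {p : ℕ}, I p → p < f → χ (p : ZMod f) ≠ 1
  eq_one : ∀ {p : ℕ}, p.Prime → p < f → ¬ I p → χ (p : ZMod f) = 1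
  left : I q₁
  left_le : ∀ {p}, I p → q₁ ≤ p
  right : I q₂
  lt : q₁ < q₂
  right_le : ∀ {p}, I p → q₁ < p → q₂ ≤ p

/-! ### Elementary construction of the splitting of `f` -/

namespace CubicInertData

variable {f : ℕ} {χ : DirichletCharacter ℂ f} {I : ℕ → Prop} {q₁ q₂ : ℕ}

theorem map_eq_one (D : CubicInertData χ I q₁ q₂) {n : ℕ} (h0 : 0 < n) (hn : n < f)
    (h : ∀ p, p ∣ n → ¬ I p) : χ (n : ZMod f) = 1 := by
  induction n using Nat.recOnMul with
  | zero => omega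
  | one => simp
  | prime p hp => exact D.eq_one hp hn (h p dvd_rfl)
  | mul a b ha hb =>
    have ha0 : 0 < a := Nat.pos_of_mul_pos_right h0
    have hb0 : 0 < b := Nat.pos_of_mul_pos_left h0
    rw [Nat.cast_mul, map_mul, ha ha0 (by nlinarith) fun p hp => h p (hp.mul_right b),
      hb hb0 (by nlinarith) fun p hp => h p (hp.mul_left a), one_mul]

theorem map_eq_one_of_lt (D : CubicInertData χ I q₁ q₂) {n : ℕ} (h0 : 0 < n) (hn : n < f)
    (h2 : n < q₂) (h1 : ¬ q₁ ∣ n) : χ (n : ZMod f) = 1 := by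
  refine D.map_eq_one h0 hn fun p hp hI => ?_
  have := Nat.le_of_dvd h0 hp
  rcases (D.left_le hI).eq_or_lt with rfl | h
  · exact h1 hp
  · have := D.right_le hI h
    omega

theorem map_eq_one_of_lt_left (D : CubicInertData χ I q₁ q₂) {n : ℕ} (h0 : 0 < n) (hn : n < f)
    (h1 : n < q₁) : χ (n : ZMod f) = 1 :=
  D.map_eq_one_of_lt h0 hn (h1.trans D.lt) fun h => by have := Nat.le_of_dvd h0 h; omega

/-- An inert prime factor is at least `q₁`, so below `2 * q₁` the cofactor must be 1. -/
theorem map_eq_one_or (D : CubicInertData χ I q₁ q₂) {n : ℕ} (h0 : 0 < n) (hn : n < f)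
    (h2 : n < 2 * q₁) (h1 : n ≠ q₁) :
    (χ (n : ZMod f) = 1 ∧ ¬ q₂ ∣ n) ∨ (I n ∧ q₂ ≤ n) := by
  by_cases hI : I n
  · exact .inr ⟨hI, D.right_le hI (lt_of_le_of_ne (D.left_le hI) h1.symm)⟩
  · have key : ∀ p, p ∣ n → ¬ I p := by
      rintro p ⟨t, rfl⟩ hp
      have := D.left_le hp
      have : t < 2 := by
        by_contra! h
        nlinarith
      interval_cases t
      · omega
      · exact hI (by simpa using hp)
    exact .inl ⟨D.map_eq_one h0 hn key, fun h => key _ h D.right⟩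

theorem eq_or_eq_inv {x y : ℂ} (hx : x ^ 3 = 1) (hy : y ^ 3 = 1) (hx1 : x ≠ 1) (hy1 : y ≠ 1) :
    y = x ∨ y = x⁻¹ := by
  have h1 : x ^ 2 + x + 1 = 0 :=
    (mul_eq_zero.1 (show (x - 1) * (x ^ 2 + x + 1) = 0 by linear_combination hx)).resolve_left
      (sub_ne_zero.2 hx1)
  have h2 : y ^ 2 + y + 1 = 0 :=
    (mul_eq_zero.1 (show (y - 1) * (y ^ 2 + y + 1) = 0 by linear_combination hy)).resolve_left
      (sub_ne_zero.2 hy1)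
  rcases mul_eq_zero.1 (show (y - x) * (x + y + 1) = 0 by linear_combination h2 - h1) with h | h
  · exact .inl (sub_eq_zero.1 h)
  · exact .inr (eq_inv_of_mul_eq_one_left (by linear_combination x * h - h1))

theorem not_dvd_of_abs_lt {q : ℕ} {a : ℤ} (h0 : a ≠ 0) (h : |a| < q) : ¬ (q : ℤ) ∣ a :=
  fun hd => h0 (Int.eq_zero_of_abs_lt_dvd hd h)

-- The bound with `3 * r` covers `q₂ * r * k` for `k < 3 * q₁`; the one with `10 * q₁` covers the
-- exceptional cases with `r ≤ p < 2 * q₁`.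
set_option maxHeartbeats 1000000 in
theorem exists_splitting (D : CubicInertData χ I q₁ q₂) (hq₁ : q₁ ≠ 2) {r : ℕ}
    (hr : IsSmallestAuxiliary χ q₁ q₂ r) (hb3 : q₁ * q₂ * (3 * r) ≤ f)
    (hb10 : q₁ * q₂ * (10 * q₁) ≤ f) :
    ∃ a : ℕ, 0 < a ∧ a < f ∧ χ (a : ZMod f) = 1 ∧ HasNonCubePart I a ∧
      HasNonCubePart I (f - a) := by
  obtain ⟨⟨hr0, hrc, hrχ⟩, hrmin⟩ := hr
  have hp1 := D.prime D.left
  have hp2 := D.prime D.right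
  have hlt := D.lt
  have hq3 : 3 ≤ q₁ := by have := hp1.two_le; omega
  have hodd : q₁ % 2 = 1 := (hp1.eq_two_or_odd).resolve_left hq₁
  have hrc1 : ¬ q₁ ∣ r := (hp1.coprime_iff_not_dvd).1 (hrc.symm.coprime_mul_right)
  have hrc2 : ¬ q₂ ∣ r := (hp2.coprime_iff_not_dvd).1 (hrc.symm.coprime_mul_left)
  have hP1 : Prime (q₁ : ℤ) := Nat.prime_iff_prime_int.1 hp1
  have hn2 : ¬ (q₁ : ℤ) ∣ 2 := not_dvd_of_abs_lt (by norm_num) (by norm_num; omega)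
  have hnq2 : ¬ (q₁ : ℤ) ∣ q₂ := by
    rw [Int.natCast_dvd_natCast, Nat.prime_dvd_prime_iff_eq hp1 hp2]; omega
  have hnr : ¬ (q₁ : ℤ) ∣ r := by rwa [Int.natCast_dvd_natCast]
  have hq12 : 3 * q₂ ≤ q₁ * q₂ := Nat.mul_le_mul_right _ hq3
  have hbig : 30 * (q₁ * q₂) ≤ f := by nlinarith
  have hq1f : 10 * q₁ < f := by nlinarith
  have hq2f : q₂ < f := by omega
  have hrf : r < f := by nlinarith
  -- Here `f - a = q₁ * (q₁ * M + u)`, so `q₁` divides it exactly once.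
  have fin : ∀ (a : ℕ) (M u : ℤ), 0 < a → a < f → χ (a : ZMod f) = 1 → HasNonCubePart I a →
      (f : ℤ) = a + q₁ ^ 2 * M + q₁ * u → ¬ (q₁ : ℤ) ∣ u →
      ∃ a : ℕ, 0 < a ∧ a < f ∧ χ (a : ZMod f) = 1 ∧ HasNonCubePart I a ∧
        HasNonCubePart I (f - a) := by
    intro a M u h0 hf hχ hN he hu
    refine ⟨a, h0, hf, hχ, hN, q₁, 1, ((f - a) / q₁), D.left, by norm_num, ?_, ?_⟩
    all_goals
      obtain ⟨b, rfl⟩ := Nat.exists_eq_add_of_lt hf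
      have hd : (q₁ : ℤ) ∣ (b + 1 : ℕ) := ⟨q₁ * M + u, by push_cast at he ⊢; linarith⟩
      rw [Int.natCast_dvd_natCast] at hd
      obtain ⟨c, hc⟩ := hd
      rw [show a + b + 1 - a = q₁ * c by omega, Nat.mul_div_cancel_left _ hp1.pos]
    · intro hqc
      apply hu
      have : (c : ℤ) = q₁ * M + u := by
        have hq0 : (q₁ : ℤ) ≠ 0 := hP1.ne_zero
        apply mul_left_cancel₀ hq0
        have : ((b : ℤ) + 1) = q₁ * c := by exact_mod_cast hc
        push_cast at he
        linarith
      rw [← Int.natCast_dvd_natCast, this] at hqc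
      exact (dvd_add_right (dvd_mul_right _ _)).1 hqc
    · ring
  have two : χ ((2 : ℕ) : ZMod f) = 1 :=
    D.map_eq_one_of_lt_left (by norm_num) (by omega) (by omega)
  have hx3 := D.cube q₂ hp2.pos hq2f
  have hx1 := D.ne_one D.right hq2f
  set x := χ (q₂ : ZMod f) with hx
  have hx0 : x ≠ 0 := by rintro h; rw [h] at hx3; norm_num at hx3
  have hxx : x * x = x⁻¹ := eq_inv_of_mul_eq_one_left (by rw [← hx3]; ring)
  -- multiples of `q₂ * r`
  have mulqr : ∀ (k : ℕ) (M u : ℤ), 0 < k → k < 3 * q₁ → χ (k : ZMod f) = 1 → ¬ q₂ ∣ k →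
      (f : ℤ) = (q₂ * r * k : ℕ) + q₁ ^ 2 * M + q₁ * u → ¬ (q₁ : ℤ) ∣ u →
      ∃ a : ℕ, 0 < a ∧ a < f ∧ χ (a : ZMod f) = 1 ∧ HasNonCubePart I a ∧
        HasNonCubePart I (f - a) := by
    intro k M u hk0 hk hχ hqk he hu
    refine fin (q₂ * r * k) M u (by have := hp2.pos; positivity) ?_ ?_ ?_ he hu
    · have : 0 < q₂ * r := Nat.mul_pos hp2.pos hr0
      have := Nat.mul_lt_mul_of_pos_left hk this
      linarith
    · push_cast
      rw [map_mul, map_mul, hχ, hrχ, ← hx, mul_inv_cancel₀ hx0, mul_one]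
    · exact ⟨q₂, 1, r * k, D.right, by norm_num, hp2.not_dvd_mul hrc2 hqk, by ring⟩
  -- `k` is the residue of `f / (q₂ * r)` modulo `q₁`.
  obtain ⟨k, hk0, hkq, M, hM⟩ : ∃ k : ℕ, 0 < k ∧ k < q₁ ∧ ∃ M : ℤ,
      (f : ℤ) = q₂ * r * k + q₁ * M := by
    have := Fact.mk hp1
    have hne : ((q₂ * r : ℕ) : ZMod q₁) ≠ 0 := by
      rw [Ne, ZMod.natCast_eq_zero_iff]
      exact hp1.not_dvd_mul (by rwa [Int.natCast_dvd_natCast] at hnq2) hrc1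
    have hfne : ((f : ℕ) : ZMod q₁) ≠ 0 := by
      rw [Ne, ZMod.natCast_eq_zero_iff, Nat.prime_dvd_prime_iff_eq hp1 D.prime_modulus]
      omega
    set z : ZMod q₁ := f / (q₂ * r : ℕ) with hz
    have hz0 : z ≠ 0 := div_ne_zero hfne hne
    refine ⟨z.val, Nat.pos_of_ne_zero (by simpa using hz0), z.val_lt, ?_⟩
    have : ((f - q₂ * r * z.val : ℤ) : ZMod q₁) = 0 := by
      push_cast at hz hne ⊢
      rw [ZMod.natCast_zmod_val, hz, mul_div_cancel₀ _ hne, sub_self]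
    rw [ZMod.intCast_zmod_eq_zero_iff_dvd] at this
    obtain ⟨M, hM⟩ := this
    exact ⟨M, by linarith⟩
  have ndvd_of_lt : ∀ {q n : ℕ}, 0 < n → n < q → ¬ q ∣ n := fun h0 h hd =>
    absurd (Nat.le_of_dvd h0 hd) (by omega)
  by_cases hMd : (q₁ : ℤ) ∣ M
  swap
  · exact mulqr k 0 M hk0 (by omega) (D.map_eq_one_of_lt_left hk0 (by omega) hkq)
      (ndvd_of_lt hk0 (by omega)) (by push_cast; linarith) hMd
  obtain ⟨M, rfl⟩ := hMd
  rcases Nat.even_or_odd' k with ⟨h, rfl | rfl⟩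
  swap
  -- For odd `k`, the shift `k + q₁` is even and its half is below `q₁`.
  · obtain ⟨s, hs⟩ : ∃ s, q₁ = 2 * s + 1 := ⟨q₁ / 2, by omega⟩
    have hχ : χ ((2 * (h + s + 1) : ℕ) : ZMod f) = 1 := by
      rw [Nat.cast_mul, map_mul, two, one_mul]
      exact D.map_eq_one_of_lt_left (by omega) (by omega) (by omega)
    refine mulqr (2 * (h + s + 1)) M (-(q₂ * r)) (by omega) (by omega) hχ ?_ ?_ ?_
    · exact hp2.not_dvd_mul (ndvd_of_lt (by omega) (by omega)) (ndvd_of_lt (by omega) (by omega))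
    · have : (q₁ : ℤ) = 2 * s + 1 := by exact_mod_cast hs
      push_cast at hM ⊢
      rw [hM]
      linear_combination (q₂ * r : ℤ) * this
    · rw [dvd_neg]; exact hP1.not_dvd_mul hnq2 hnr
  push_cast at hM
  -- For `k = 2 * h`, try `k + q₁`, then `k + 2 * q₁ = 2 * (h + q₁)`.
  rcases D.map_eq_one_or (n := 2 * h + q₁) (by omega) (by omega) (by omega) (by omega) with
    ⟨hχ, hd⟩ | ⟨hIp, -⟩
  · refine mulqr _ M (-(q₂ * r)) (by omega) (by omega) hχ hd ?_ ?_
    · push_cast; linarith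
    · rw [dvd_neg]; exact hP1.not_dvd_mul hnq2 hnr
  rcases D.map_eq_one_or (n := h + q₁) (by omega) (by omega) (by omega) (by omega) with
    ⟨hχ, hd⟩ | ⟨hIp', hp'2⟩
  · refine mulqr (2 * (h + q₁)) M (-(2 * (q₂ * r))) (by omega) (by omega) ?_ ?_ ?_ ?_
    · rw [Nat.cast_mul, map_mul, two, one_mul, hχ]
    · exact hp2.not_dvd_mul (ndvd_of_lt (by omega) (by omega)) hd
    · push_cast; linarith
    · rw [dvd_neg]; exact hP1.not_dvd_mul hn2 (hP1.not_dvd_mul hnq2 hnr)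
  -- now both `p = 2 * h + q₁` and `p' = h + q₁` are inert
  obtain ⟨p, hpdef⟩ : ∃ p, p = 2 * h + q₁ := ⟨_, rfl⟩
  obtain ⟨p', hp'def⟩ : ∃ p', p' = h + q₁ := ⟨_, rfl⟩
  rw [← hpdef] at hIp
  rw [← hp'def] at hIp' hp'2
  have hpZ : (p : ℤ) = 2 * h + q₁ := by exact_mod_cast hpdef
  have hp'Z : (p' : ℤ) = h + q₁ := by exact_mod_cast hp'def
  have pp := D.prime hIp
  have pp' := D.prime hIp'
  have hpf : p < f := by omega
  have hp'f : p' < f := by omega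
  have hnp : ¬ (q₁ : ℤ) ∣ p := by
    rw [Int.natCast_dvd_natCast, Nat.prime_dvd_prime_iff_eq hp1 pp]; omega
  have cop : ∀ {n}, n.Prime → n ≠ q₁ → n ≠ q₂ → Nat.Coprime n (q₁ * q₂) := fun hn h1 h2 =>
    Nat.Coprime.mul_right ((Nat.coprime_primes hn hp1).2 h1) ((Nat.coprime_primes hn hp2).2 h2)
  have copp : Nat.Coprime p (q₁ * q₂) := cop pp (by omega) (by omega)
  obtain ⟨d, hd⟩ : ∃ d, q₂ = q₁ + d := ⟨q₂ - q₁, by omega⟩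
  have hdZ : (q₂ : ℤ) = q₁ + d := by exact_mod_cast hd
  have hd1 : χ (d : ZMod f) = 1 := D.map_eq_one_of_lt_left (by omega) (by omega) (by omega)
  have hχp := eq_or_eq_inv hx3 (D.cube p pp.pos hpf) hx1 (D.ne_one hIp hpf)
  have hχp' := eq_or_eq_inv hx3 (D.cube p' pp'.pos hp'f) hx1 (D.ne_one hIp' hp'f)
  rcases hχp with hχp | hχp
  -- The candidate `p * r * d` could contain `p` to the third power only if `p ^ 2 ∣ r`; minimality
  -- then forces `r = p ^ 2`.
  · by_cases hpr : p ^ 2 ∣ r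
    · have hrp : r = p ^ 2 := by
        refine le_antisymm (hrmin ⟨by have := pp.pos; positivity, copp.pow_left 2, ?_⟩)
          (Nat.le_of_dvd hr0 hpr)
        push_cast
        rw [map_pow, hχp, sq, hxx]
      have hpp' : p' < p := by omega
      -- Otherwise `p'` or `p' ^ 2` would be an admissible value below `r = p ^ 2`.
      have hp'q : p' = q₂ := by
        by_contra hne
        have copp' : Nat.Coprime p' (q₁ * q₂) := cop pp' (by omega) hne
        rcases hχp' with h' | h'
        · have := hrmin ⟨by have := pp'.pos; positivity, copp'.pow_left 2, by
            push_cast; rw [map_pow, h', sq, hxx]⟩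
          have := Nat.pow_lt_pow_left hpp' two_ne_zero
          omega
        · have := hrmin ⟨pp'.pos, copp', h'⟩
          have := Nat.le_self_pow two_ne_zero p
          omega
      have hh : χ (h : ZMod f) = 1 := D.map_eq_one_of_lt_left (by omega) (by omega) (by omega)
      -- The character value is `χ q₂ ^ 3 = 1`, and `p - 2 * q₂ = -q₁` produces the factor `q₁`.
      refine fin (p * (q₂ ^ 2 * (2 * (2 * h)))) M (-(2 * (h * (q₂ * p)))) ?_ ?_ ?_ ?_ ?_ ?_
      · have := pp.pos
        have := hp2.pos
        have : 0 < h := by omega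
        positivity
      · subst hrp
        have h1 : q₂ * (2 * (2 * h)) < 3 * q₁ * p := by
          have := Nat.mul_lt_mul'' (show q₂ < p by omega) (show 2 * (2 * h) < 3 * q₁ by omega)
          linarith
        have := Nat.mul_lt_mul_of_pos_left h1 (Nat.mul_pos pp.pos hp2.pos)
        linarith
      · push_cast at two ⊢
        simp only [map_mul, map_pow, two, hh, hχp, ← hx]
        linear_combination hx3
      · refine ⟨p, 1, q₂ ^ 2 * (2 * (2 * h)), hIp, by norm_num, ?_, by ring⟩
        have h2 : ¬ p ∣ 2 := ndvd_of_lt (by omega) (by omega)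
        refine pp.not_dvd_mul (fun h => ndvd_of_lt hp2.pos (by omega) (pp.dvd_of_dvd_pow h))
          (pp.not_dvd_mul h2 (pp.not_dvd_mul h2 (ndvd_of_lt (by omega) (by omega))))
      · rw [hM, hrp]
        have : (q₂ : ℤ) = h + q₁ := by rw [← hp'Z, hp'q]
        push_cast
        rw [this, hpZ]
        ring
      · rw [dvd_neg]
        exact hP1.not_dvd_mul hn2 (hP1.not_dvd_mul
          (by rw [Int.natCast_dvd_natCast]; exact ndvd_of_lt (by omega) (by omega))
          (hP1.not_dvd_mul hnq2 hnp))
    · have hpd : ¬ p ∣ d := ndvd_of_lt (by omega) (by omega)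
      -- With `2 * h = p - q₁` and `d = q₂ - q₁`, one has `q₂ * (p - q₁) - p * (q₂ - q₁) = q₁ * (p -
      -- q₂)`. The same exchange identity is used for the later pairs `p', q₂` and `p, r`.
      refine fin (p * r * d) M (r * (p - q₂)) ?_ ?_ ?_ ?_ ?_ ?_
      · have := pp.pos
        have : 0 < d := by omega
        positivity
      · have := Nat.mul_lt_mul'' (show p < 3 * q₁ by omega) (show d < q₂ by omega)
        have := Nat.mul_lt_mul_of_pos_left this hr0
        linarith
      · push_cast
        rw [map_mul, map_mul, hd1, hrχ, hχp, mul_inv_cancel₀ hx0, mul_one]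
      · by_cases hpr1 : p ∣ r
        · obtain ⟨m, rfl⟩ := hpr1
          refine ⟨p, 2, m * d, hIp, by norm_num, pp.not_dvd_mul (fun h => hpr ?_) hpd, by ring⟩
          rw [sq]; exact mul_dvd_mul_left p h
        · exact ⟨p, 1, r * d, hIp, by norm_num, pp.not_dvd_mul hpr1 hpd, by ring⟩
      · rw [hM]
        push_cast
        rw [hpZ, hdZ]
        ring
      · refine hP1.not_dvd_mul hnr (not_dvd_of_abs_lt (by omega) ?_)
        rw [abs_lt]; constructor <;> omega
  · have hrp : r ≤ p := hrmin ⟨pp.pos, copp, hχp⟩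
    rcases hrp.eq_or_lt with rfl | hrp
    · by_cases hp'q : p' = q₂
      -- `h = q₂ - q₁` is a difference of odd primes, so `k = 4 * g` and the shift `k + 4 * q₁` is
      -- available.
      · obtain ⟨g, rfl⟩ : ∃ g, h = 2 * g := ⟨h / 2, by
          have := hp2.eq_two_or_odd
          omega⟩
        have hg : χ ((g + q₁ : ℕ) : ZMod f) = 1 := by
          refine D.map_eq_one_of_lt (by omega) (by omega) (by omega) ?_
          rw [Nat.dvd_add_left dvd_rfl]
          exact ndvd_of_lt (by omega) (by omega)
        refine fin (q₂ * (r * (2 * (2 * (g + q₁))))) M (-(2 * (2 * (q₂ * r)))) ?_ ?_ ?_ ?_ ?_ ?_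
        · have := hp2.pos
          positivity
        · have := Nat.mul_lt_mul'' (show r < 2 * q₁ by omega)
            (show 2 * (2 * (g + q₁)) < 5 * q₁ by omega)
          have := Nat.mul_lt_mul_of_pos_left this hp2.pos
          linarith
        · push_cast at two hg ⊢
          simp only [map_mul, two, hg, hχp, ← hx, mul_one]
          exact mul_inv_cancel₀ hx0
        · have h2 : ¬ q₂ ∣ 2 := ndvd_of_lt (by omega) (by omega)
          exact ⟨q₂, 1, r * (2 * (2 * (g + q₁))), D.right, by norm_num, hp2.not_dvd_mul hrc2
            (hp2.not_dvd_mul h2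
            (hp2.not_dvd_mul h2 (ndvd_of_lt (by omega) (by omega)))), by rw [pow_one]⟩
        · rw [hM]; push_cast; ring
        · rw [dvd_neg]
          exact hP1.not_dvd_mul hn2 (hP1.not_dvd_mul hn2 (hP1.not_dvd_mul hnq2 hnr))
      · have hχ' : χ (p' : ZMod f) = x := by
          refine hχp'.resolve_right fun h' => ?_
          have := hrmin ⟨pp'.pos, cop pp' (by omega) hp'q, h'⟩
          omega
        refine fin (r * (2 * (p' * d))) M (r * (2 * (p' - q₂))) ?_ ?_ ?_ ?_ ?_ ?_
        · have := pp'.pos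
          have : 0 < d := by omega
          positivity
        · have := Nat.mul_lt_mul'' (show p' < 2 * q₂ by omega) (show 2 * d < q₁ by omega)
          have := Nat.mul_lt_mul'' (show r < 5 * q₁ by omega) this
          linarith
        · push_cast at two ⊢
          simp only [map_mul, two, hd1, hχp, hχ', one_mul, mul_one]
          exact inv_mul_cancel₀ hx0
        · refine ⟨r, 1, 2 * (p' * d), hIp, by norm_num, pp.not_dvd_mul (ndvd_of_lt (by omega) (by omega))
            (pp.not_dvd_mul (ndvd_of_lt (by omega) (by omega))
              (ndvd_of_lt (by omega) (by omega))), by rw [pow_one]⟩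
        · rw [hM]
          push_cast
          rw [hp'Z, hpZ, hdZ]
          ring
        · refine hP1.not_dvd_mul hnr (hP1.not_dvd_mul hn2 (not_dvd_of_abs_lt (by omega) ?_))
          rw [abs_lt]; constructor <;> omega
    · have hr1 : r ≠ q₁ := by rintro rfl; exact hrc1 dvd_rfl
      have hr2 : r ≠ q₂ := by rintro rfl; exact hrc2 dvd_rfl
      have hrq : q₂ ≤ r := by
        rcases D.map_eq_one_or hr0 hrf (by omega) hr1 with ⟨h1, -⟩ | ⟨-, h⟩
        · rw [hrχ, inv_eq_one] at h1
          exact absurd h1 hx1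
        · exact h
      obtain ⟨e, he⟩ : ∃ e, r = q₁ + e := ⟨r - q₁, by omega⟩
      have heZ : (r : ℤ) = q₁ + e := by exact_mod_cast he
      have he1 : χ (e : ZMod f) = 1 := D.map_eq_one_of_lt_left (by omega) (by omega) (by omega)
      refine fin (q₂ * (p * e)) M (q₂ * (p - r)) ?_ ?_ ?_ ?_ ?_ ?_
      · have := pp.pos
        have := hp2.pos
        have : 0 < e := by omega
        positivity
      · have := Nat.mul_lt_mul'' (show p < 10 * q₁ by omega) (show e < q₁ by omega)
        have := Nat.mul_lt_mul_of_pos_left this hp2.pos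
        linarith
      · push_cast
        rw [map_mul, map_mul, he1, hχp, ← hx, mul_one, mul_inv_cancel₀ hx0]
      · exact ⟨q₂, 1, p * e, D.right, by norm_num, hp2.not_dvd_mul
          (by rw [Nat.prime_dvd_prime_iff_eq hp2 pp]; omega)
          (ndvd_of_lt (by omega) (by omega)), by rw [pow_one]⟩
      · rw [hM]
        push_cast
        rw [hpZ, heZ]
        ring
      · refine hP1.not_dvd_mul hnq2 (not_dvd_of_abs_lt (by omega) ?_)
        rw [abs_lt]; constructor <;> omega

end CubicInertData

/-! ### Decomposition of primes in subfields of cyclotomic fields -/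

section PrimeDecomposition

open Ideal

variable {K L : Type*} [Field K] [Field L] [NumberField L]

theorem inertiaDeg_eq_one_of_ringHom_cyclotomic {p : ℕ} [Fact p.Prime]
    [IsCyclotomicExtension {p} ℚ L] (φ : K →+* L) (P : Ideal (𝓞 K)) [P.IsPrime]
    [P.LiesOver (span {(p : ℤ)})] : P.inertiaDeg ℤ = 1 := by
  let := φ.toAlgebra
  obtain ⟨⟨Q, _, _⟩⟩ := P.nonempty_primesOver (S := 𝓞 L)
  have : Q.LiesOver (span {(p : ℤ)}) := LiesOver.trans Q P _
  have h := inertiaDeg_tower (R := ℤ) P Q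
  rw [IsCyclotomicExtension.Rat.inertiaDeg_eq_of_prime p L Q] at h
  exact Nat.eq_one_of_mul_eq_one_right h.symm

variable [NumberField K]

theorem ramificationIdx_eq_one_of_ringHom_cyclotomic {m p : ℕ} [NeZero m] [Fact p.Prime]
    [IsCyclotomicExtension {m} ℚ L] (φ : K →+* L) (hm : ¬ p ∣ m) (P : Ideal (𝓞 K)) [P.IsPrime]
    [P.LiesOver (span {(p : ℤ)})] : P.ramificationIdx ℤ = 1 := by
  let := φ.toAlgebra
  obtain ⟨⟨Q, _, _⟩⟩ := P.nonempty_primesOver (S := 𝓞 L)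
  have : Q.LiesOver (span {(p : ℤ)}) := LiesOver.trans Q P _
  have h := ramificationIdx_tower (R := ℤ) P Q
  rw [IsCyclotomicExtension.Rat.ramificationIdx_eq_of_not_dvd p L Q hm] at h
  exact Nat.eq_one_of_mul_eq_one_right h.symm

theorem ncard_primesOver_eq_one_of_ringHom_cyclotomic [IsGalois ℚ K] {p : ℕ} [Fact p.Prime]
    [IsCyclotomicExtension {p} ℚ L] (φ : K →+* L) :
    ((span {(p : ℤ)}).primesOver (𝓞 K)).ncard = 1 := by
  let := φ.toAlgebra
  have := IsCyclotomicExtension.isGalois {p} ℚ L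
  have : (span {(p : ℤ)}).IsPrime := by
    rw [span_singleton_prime (by simpa using (Fact.out : p.Prime).ne_zero)]
    exact Nat.prime_iff_prime_int.1 Fact.out
  obtain ⟨⟨P, _, _⟩⟩ := (span {(p : ℤ)}).nonempty_primesOver (S := 𝓞 K)
  have h := ncard_primesOver_mul_ncard_primesOver (p := span {(p : ℤ)}) P Gal(K/ℚ)
    (𝓞 L) Gal(L/ℚ)
  rw [IsCyclotomicExtension.Rat.ncard_primesOver_of_prime p L] at h
  exact Nat.eq_one_of_mul_eq_one_right h

theorem IsInertPrime.ncard_primesOver {p : ℕ} (hp : IsInertPrime K p) :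
    ((span {(p : ℤ)}).primesOver (𝓞 K)).ncard = 1 := by
  obtain ⟨hp, hP⟩ := hp
  have := Fact.mk hp
  have hPrime : (span {(p : ℤ)}).IsPrime := by
    rw [span_singleton_prime (by simpa using hp.ne_zero)]
    exact Nat.prime_iff_prime_int.1 hp
  have hsub : ∀ Q ∈ (span {(p : ℤ)}).primesOver (𝓞 K), Q = span {(p : 𝓞 K)} := by
    rintro Q ⟨hQ, hQp⟩
    have hmem : (p : 𝓞 K) ∈ Q := by
      have : (p : ℤ) ∈ Q.under ℤ := by rw [← hQp.over]; exact mem_span_singleton_self _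
      simpa [mem_comap] using this
    have hmax : (span {(p : 𝓞 K)}).IsMaximal := hP.isMaximal (by simpa using hp.ne_zero)
    exact (hmax.eq_of_le hQ.ne_top (by simpa [span_singleton_le_iff_mem] using hmem)).symm
  obtain ⟨⟨P, hP⟩⟩ := (span {(p : ℤ)}).nonempty_primesOver (S := 𝓞 K)
  rw [Set.ncard_eq_one]
  exact ⟨P, Set.eq_singleton_iff_unique_mem.2 ⟨hP, fun Q hQ => (hsub Q hQ).trans (hsub P hP).symm⟩⟩

/-- Ramification is trivial away from `m`, so the number of primes times the inertia degree is 3. -/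
theorem isInertPrime_or_splitsIn [IsGalois ℚ K] (h3 : Module.finrank ℚ K = 3) {m p : ℕ} [NeZero m]
    (hp : p.Prime) [IsCyclotomicExtension {m} ℚ L] (φ : K →+* L) (hm : ¬ p ∣ m) :
    IsInertPrime K p ∨ SplitsIn K p := by
  have := Fact.mk hp
  have hPrime : (span {(p : ℤ)}).IsPrime := by
    rw [span_singleton_prime (by simpa using hp.ne_zero)]
    exact Nat.prime_iff_prime_int.1 hp
  obtain ⟨⟨P, _, _⟩⟩ := (span {(p : ℤ)}).nonempty_primesOver (S := 𝓞 K)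
  have h := ncard_primesOver_mul_ramificationIdxIn_mul_inertiaDegIn (span {(p : ℤ)}) (𝓞 K)
    Gal(K/ℚ)
  rw [ramificationIdxIn_eq_ramificationIdx (span {(p : ℤ)}) P Gal(K/ℚ),
    inertiaDegIn_eq_inertiaDeg (span {(p : ℤ)}) P Gal(K/ℚ),
    ramificationIdx_eq_one_of_ringHom_cyclotomic φ hm P, one_mul,
    IsGalois.card_aut_eq_finrank, h3] at h
  rcases (Nat.dvd_prime Nat.prime_three).1 (Dvd.intro _ h) with h1 | h1
  · refine .inl ⟨hp, ?_⟩
    rw [h1, one_mul] at h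
    have hnorm := pow_inertiaDeg p P
    rw [h] at hnorm
    have hmem : (p : 𝓞 K) ∈ P := by
      have : (p : ℤ) ∈ P.under ℤ := by
        rw [← LiesOver.over (P := P) (p := span {(p : ℤ)})]
        exact mem_span_singleton_self _
      simpa [mem_comap] using this
    obtain ⟨J, hJ⟩ := dvd_iff_le.2 ((span_singleton_le_iff_mem P).2 hmem)
    -- `P` contains `p` and has the same norm `p ^ 3` as the ideal it generates, so the two
    -- coincide.
    have hpn : absNorm (span {(p : 𝓞 K)}) = p ^ 3 := by
      rw [absNorm_span_singleton, show (p : 𝓞 K) = algebraMap ℤ (𝓞 K) p by simp,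
        Algebra.norm_algebraMap, RingOfIntegers.rank, h3]
      simp [Int.natAbs_pow]
    rw [hJ, map_mul, ← hnorm] at hpn
    have hJ1 : absNorm J = 1 :=
      Nat.eq_of_mul_eq_mul_left (pow_pos hp.pos 3) (by rw [hpn, mul_one])
    rw [absNorm_eq_one_iff] at hJ1
    rw [hJ, hJ1, mul_top]
    infer_instance
  · exact .inr ⟨hp, by rw [h1, h3]⟩

end PrimeDecomposition

/-! ### Norms and the Euclidean property -/

section Norm

variable {K L : Type*} [Field K] [NumberField K] [Field L] [NumberField L]

theorem algebraMap_norm_eq_prod_smul [IsGalois ℚ K] (x : 𝓞 K) :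
    algebraMap ℤ (𝓞 K) (Algebra.norm ℤ x) = ∏ σ : Gal(K/ℚ), σ • x := by
  apply RingOfIntegers.coe_injective
  have h := Algebra.norm_eq_prod_automorphisms ℚ (x : K)
  rw [← Algebra.coe_norm_int] at h
  rw [map_prod]
  simpa [map_prod] using! h

theorem IsNormEuclidean.exists_eq_span (hE : IsNormEuclidean K) (I : Ideal (𝓞 K)) (hI : I ≠ ⊥) :
    ∃ π : 𝓞 K, π ≠ 0 ∧ I = Ideal.span {π} := by
  obtain ⟨β, ⟨hβ, hβ0⟩, hmin⟩ := WellFounded.has_min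
    (InvImage.wf (fun x : 𝓞 K => (Algebra.norm ℤ x).natAbs) wellFounded_lt)
    {x : 𝓞 K | x ∈ I ∧ x ≠ 0} ((Submodule.ne_bot_iff I).1 hI)
  refine ⟨β, hβ0, le_antisymm (fun α hα => ?_) ((Ideal.span_singleton_le_iff_mem I).2 hβ)⟩
  obtain ⟨γ, hγ⟩ := hE α β hβ0
  have h0 : α - γ * β = 0 := by
    by_contra hne
    exact hmin _ ⟨I.sub_mem hα (I.mul_mem_left γ hβ), hne⟩ (by
      change (Algebra.norm ℤ (α - γ * β)).natAbs < (Algebra.norm ℤ β).natAbs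
      zify
      exact hγ)
  exact Ideal.mem_span_singleton.2 ⟨γ, by rw [mul_comm]; exact sub_eq_zero.1 h0⟩

/-- If `q` divides the product of conjugates, it divides one of them, hence `γ` itself because `q`
is Galois-fixed. Removing it takes `q ^ 3` out of the norm; then descend on `e`. -/
theorem IsInertPrime.three_dvd_of_norm_eq [IsGalois ℚ K] (h3 : Module.finrank ℚ K = 3) {q : ℕ}
    (hq : IsInertPrime K q) {m : ℤ} (hm : ¬ (q : ℤ) ∣ m) (e : ℕ) (γ : 𝓞 K)
    (h : Algebra.norm ℤ γ = q ^ e * m) : 3 ∣ e := by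
  induction e using Nat.strong_induction_on generalizing γ with
  | _ e ih =>
    rcases Nat.eq_zero_or_pos e with rfl | he
    · exact dvd_zero 3
    have hq0 : (q : 𝓞 K) ≠ 0 := by simpa using hq.1.ne_zero
    have hq0' : (q : ℤ) ≠ 0 := by simpa using hq.1.ne_zero
    have hP : Prime (q : 𝓞 K) := (Ideal.span_singleton_prime hq0).1 hq.2
    have hdvd : (q : 𝓞 K) ∣ ∏ σ : Gal(K/ℚ), σ • γ := by
      rw [← algebraMap_norm_eq_prod_smul, h, map_mul, map_pow]
      simpa using (dvd_pow_self (q : 𝓞 K) he.ne').mul_right _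
    obtain ⟨σ, -, δ, hδ⟩ := (hP.dvd_finsetProd_iff _).1 hdvd
    have hγ : γ = (q : 𝓞 K) * (σ⁻¹ • δ) := by
      have := congrArg (σ⁻¹ • ·) hδ
      have hqσ : σ⁻¹ • (q : 𝓞 K) = q := map_natCast (MulSemiringAction.toRingHom _ (𝓞 K) σ⁻¹) q
      simpa [smul_mul', hqσ] using this
    have hN : Algebra.norm ℤ γ = q ^ 3 * Algebra.norm ℤ (σ⁻¹ • δ) := by
      rw [hγ, map_mul, show (q : 𝓞 K) = algebraMap ℤ (𝓞 K) q by simp, Algebra.norm_algebraMap,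
        RingOfIntegers.rank, h3]
    rw [hN] at h
    have he3 : 3 ≤ e := by
      by_contra! hlt
      apply hm
      obtain ⟨c, hc⟩ : ∃ c, 3 = e + (c + 1) := ⟨2 - e, by omega⟩
      rw [hc, pow_add, mul_assoc] at h
      rw [← mul_left_cancel₀ (pow_ne_zero e hq0') h]
      exact (dvd_pow_self _ (Nat.succ_ne_zero c)).mul_right _
    obtain ⟨c, rfl⟩ := Nat.exists_eq_add_of_le he3
    rw [pow_add, mul_assoc] at h
    have := ih c (by omega) _ (mul_left_cancel₀ (pow_ne_zero 3 hq0') h)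
    omega

/-- In a norm-Euclidean Galois cubic field the residue of smallest norm of an integer modulo the
generator of a totally ramified prime above `f` has norm congruent to a cube modulo `f`. -/
theorem IsNormEuclidean.exists_norm_modEq_cube [IsGalois ℚ K] (h3 : Module.finrank ℚ K = 3)
    (hE : IsNormEuclidean K) {f : ℕ} (hf : f.Prime) [IsCyclotomicExtension {f} ℚ L]
    (φ : K →+* L) (x : ℤ) :
    ∃ γ : 𝓞 K, |Algebra.norm ℤ γ| < f ∧ (f : ℤ) ∣ Algebra.norm ℤ γ - x ^ 3 := by
  have := Fact.mk hf
  have hPrime : (Ideal.span {(f : ℤ)}).IsPrime := by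
    rw [Ideal.span_singleton_prime (by simpa using hf.ne_zero)]
    exact Nat.prime_iff_prime_int.1 hf
  obtain ⟨P, hP⟩ := Set.ncard_eq_one.1 (ncard_primesOver_eq_one_of_ringHom_cyclotomic (p := f) φ)
  obtain ⟨_, hover⟩ : P ∈ (Ideal.span {(f : ℤ)}).primesOver (𝓞 K) := hP ▸ Set.mem_singleton P
  have hnorm := Ideal.pow_inertiaDeg f P
  rw [inertiaDeg_eq_one_of_ringHom_cyclotomic (p := f) φ P, pow_one] at hnorm
  have hP0 : P ≠ ⊥ := by
    rintro rfl
    exact hf.ne_zero (by simpa using hnorm)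
  obtain ⟨π, hπ0, rfl⟩ := hE.exists_eq_span P hP0
  rw [Ideal.absNorm_span_singleton] at hnorm
  obtain ⟨δ, hδ⟩ := hE x π hπ0
  refine ⟨x - δ * π, ?_, ?_⟩
  · rwa [hnorm, Int.natCast_natAbs]
  · set γ : 𝓞 K := x - δ * π with hγ
    have hmem : γ - x ∈ Ideal.span {π} := Ideal.mem_span_singleton.2 ⟨-δ, by rw [hγ]; ring⟩
    -- The only prime above `f` is Galois-stable, so every conjugate of `γ` is congruent to `x`.
    have hσ : ∀ σ : Gal(K/ℚ), σ • γ - x ∈ Ideal.span {π} := by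
      intro σ
      have h1 := Ideal.smul_mem_pointwise_smul σ _ _ hmem
      have h2 : σ • Ideal.span {π} ∈ (Ideal.span {(f : ℤ)}).primesOver (𝓞 K) :=
        ⟨inferInstance, inferInstance⟩
      rw [hP, Set.mem_singleton_iff] at h2
      rw [h2, smul_sub] at h1
      have hx : σ • (x : 𝓞 K) = x := map_intCast (MulSemiringAction.toRingHom _ (𝓞 K) σ) x
      rwa [hx] at h1
    have hprod : algebraMap ℤ (𝓞 K) (Algebra.norm ℤ γ - x ^ 3) ∈ Ideal.span {π} := by
      rw [← Ideal.Quotient.eq_zero_iff_mem, map_sub, map_sub, algebraMap_norm_eq_prod_smul,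
        map_prod, Finset.prod_congr rfl fun σ _ => Ideal.Quotient.eq.2 (hσ σ), Finset.prod_const,
        Finset.card_univ, ← Nat.card_eq_fintype_card, IsGalois.card_aut_eq_finrank, h3]
      simp
    rw [← Ideal.mem_span_singleton, hover.over]
    exact hprod

end Norm

/-! ### Cubic characters modulo a prime -/

section Character

variable {f : ℕ} {χ : DirichletCharacter ℂ f}

theorem DirichletCharacter.pow_three_eq_one_of_orderOf (hf : f.Prime) (hχ : orderOf χ = 3) {n : ℕ}
    (h0 : 0 < n) (hn : n < f) : χ (n : ZMod f) ^ 3 = 1 := by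
  have hu : IsUnit (n : ZMod f) :=
    (ZMod.isUnit_iff_coprime n f).2 (hf.coprime_iff_not_dvd.2 (Nat.not_dvd_of_pos_of_lt h0 hn)).symm
  rw [← MulChar.pow_apply' χ (by norm_num), ← hχ, pow_orderOf_eq_one, MulChar.one_apply hu]

/-- The unit group is cyclic and `χ` sends a generator to an element of order 3, so the kernel
consists of the cubes. -/
theorem DirichletCharacter.exists_cube_of_map_eq_one (hf : f.Prime) (hχ : orderOf χ = 3)
    {a : ZMod f} (ha : χ a = 1) : ∃ x : ZMod f, x ^ 3 = a := by
  have := Fact.mk hf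
  have hu : IsUnit a := by
    by_contra hu
    rw [χ.map_nonunit hu] at ha
    exact zero_ne_one ha
  obtain ⟨u, rfl⟩ := hu
  obtain ⟨g, hg⟩ := IsCyclic.exists_monoid_generator (α := (ZMod f)ˣ)
  obtain ⟨k, rfl⟩ := Submonoid.mem_powers_iff _ _ |>.1 (hg u)
  have hg3 : χ (g : ZMod f) ^ 3 = 1 := by
    rw [← MulChar.pow_apply' χ (by norm_num), ← hχ, pow_orderOf_eq_one,
      MulChar.one_apply g.isUnit]
  have hg1 : χ (g : ZMod f) ≠ 1 := by
    intro h1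
    have : χ = 1 := MulChar.ext fun v => by
      obtain ⟨j, rfl⟩ := Submonoid.mem_powers_iff _ _ |>.1 (hg v)
      rw [Units.val_pow_eq_pow_val, map_pow, h1, one_pow, MulChar.one_apply (g.isUnit.pow j)]
    rw [this, orderOf_one] at hχ
    norm_num at hχ
  have hord : orderOf (χ (g : ZMod f)) = 3 := orderOf_eq_prime hg3 hg1
  rw [Units.val_pow_eq_pow_val, map_pow] at ha
  obtain ⟨j, rfl⟩ := hord ▸ orderOf_dvd_of_pow_eq_one ha
  exact ⟨(g : ZMod f) ^ j, by rw [Units.val_pow_eq_pow_val, ← pow_mul, mul_comm]⟩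

end Character

/-! ### Heilbronn's criterion and the conclusion -/

/-- Heilbronn's criterion for cyclic cubic fields of prime conductor. -/
theorem not_isNormEuclidean_of_splitting {K L : Type*} [Field K] [NumberField K] [IsGalois ℚ K]
    [Field L] [NumberField L]
    (h3 : Module.finrank ℚ K = 3) {f : ℕ} (hf : f.Prime) [IsCyclotomicExtension {f} ℚ L]
    (φ : K →+* L)
    {χ : DirichletCharacter ℂ f} (hχ : orderOf χ = 3) {a : ℕ} (ha0 : 0 < a) (haf : a < f)
    (ha : χ (a : ZMod f) = 1) (h1 : HasNonCubePart (IsInertPrime K) a)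
    (h2 : HasNonCubePart (IsInertPrime K) (f - a)) : ¬ IsNormEuclidean K := by
  intro hE
  obtain ⟨x, hx⟩ := DirichletCharacter.exists_cube_of_map_eq_one hf hχ ha
  obtain ⟨y, rfl⟩ := ZMod.intCast_surjective x
  obtain ⟨γ, hlt, hdvd⟩ := hE.exists_norm_modEq_cube h3 hf φ y
  have hmod : (f : ℤ) ∣ Algebra.norm ℤ γ - a := by
    rw [← ZMod.intCast_zmod_eq_zero_iff_dvd] at hdvd ⊢
    push_cast at hdvd ⊢
    rw [← hx, hdvd]
  obtain ⟨c, hc⟩ := hmod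
  rw [abs_lt] at hlt
  have hc1 : -2 < c := by nlinarith
  have hc2 : c < 1 := by nlinarith
  -- The norm of `γ` is `a` or `a - f`.
  obtain rfl | rfl : c = 0 ∨ c = -1 := by omega
  · obtain ⟨q, e, m, hq, he, hm, rfl⟩ := h1
    exact he (hq.three_dvd_of_norm_eq h3 (m := m) (by rwa [Int.natCast_dvd_natCast]) e γ
      (by push_cast at hc; linarith))
  · obtain ⟨q, e, m, hq, he, hm, hfa⟩ := h2
    have : (f : ℤ) - a = q ^ e * m := by
      rw [← Nat.cast_sub haf.le, hfa]
      push_cast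
      rfl
    exact he (hq.three_dvd_of_norm_eq h3 (m := -m)
      (by rwa [dvd_neg, Int.natCast_dvd_natCast]) e γ (by linarith))

theorem isCyclotomicExtension_rat_cyclotomicField (n : ℕ) :
    IsCyclotomicExtension {n} ℚ (CyclotomicField n ℚ) := by
  convert! (inferInstance :
    @IsCyclotomicExtension {n} ℚ (CyclotomicField n ℚ) _ _ (CyclotomicField.algebra n ℚ))

theorem proposition5p1 (K : Type*) [Field K] [NumberField K] (hK : IsCyclicCubic K)
    (f : ℕ) (hf : f.Prime) (hcond : IsConductor K f)
    (χ : DirichletCharacter ℂ f) (hχ : IsCubicCharacterOf K χ)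
    (q₁ q₂ : ℕ) (hq : AreTwoSmallestInertPrimes K q₁ q₂)
    (r : ℕ) (hr : IsSmallestAuxiliary χ q₁ q₂ r)
    (hq₁ : q₁ ≠ 2) (hbound : q₁ * q₂ * max (3 * r) (10 * q₁) ≤ f) :
    ¬ IsNormEuclidean K := by
  obtain ⟨hG, -, h3⟩ := hK
  obtain ⟨-, φ⟩ := hcond.1
  obtain ⟨φ⟩ := φ
  have hcyc := isCyclotomicExtension_rat_cyclotomicField f
  replace φ := φ.toRingHom
  obtain ⟨-, hord, hsplit⟩ := hχ
  have := NeZero.mk hf.ne_zero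
  have D : CubicInertData χ (IsInertPrime K) q₁ q₂ :=
    { prime_modulus := hf
      cube := fun n => DirichletCharacter.pow_three_eq_one_of_orderOf hf hord
      prime := fun hp => hp.1
      ne_one := fun {p} hp _ h1 => by
        have h := ((hsplit p hp.1).2 h1).2
        rw [hp.ncard_primesOver, h3] at h
        norm_num at h
      eq_one := fun {p} hp hlt hI => (hsplit p hp).1 <|
        (isInertPrime_or_splitsIn h3 hp φ fun hd => by
          rw [Nat.prime_dvd_prime_iff_eq hp hf] at hd
          omega).resolve_left hI
      left := hq.1.1
      left_le := fun hp => hq.1.2 hp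
      right := hq.2.1.1
      lt := hq.2.1.2
      right_le := fun hp hlt => hq.2.2 ⟨hp, hlt⟩ }
  obtain ⟨a, ha0, haf, ha, h1, h2⟩ := D.exists_splitting hq₁ hr
    ((Nat.mul_le_mul_left _ (le_max_left _ _)).trans hbound)
    ((Nat.mul_le_mul_left _ (le_max_right _ _)).trans hbound)
  exact not_isNormEuclidean_of_splitting h3 hf φ hord ha0 haf ha h1 h2
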